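/- Let $\Omega=(a,b)\subset\mathbb R$ be a bounded open interval, let $f\in BV(\Omega)$, and let $\alpha\in C(\overline\Omega)$ satisfy $\alpha>0$ on $\overline\Omega$ and be weakly differentiable with weak derivative $\alpha'\in BV(\Omega)$. For $w\in BV(\Omega)$ let $Dw$ denote its distributional derivative, a finite signed Radon measure on $\Omega$, and $|Dw|$ the total variation measure of $Dw$. Let $u\in BV(\Omega)$ be a solution of the weighted total variation problem $$\min_{w\in BV(\Omega)}\ \frac12\int_\Omega (f-w)^2\,dx+\int_\Omega \alpha\,d|Dw| .$$ Let $x\in\Omega$ with $|D\alpha'|(\{x\})=0$. Then $$|Du|(\{x\})\le |Df|(\{x\}).$$ Moreover, if $u$ jumps at $x$, then $f$ jumps at $x$ in the same direction: if $Du(\{x\})>0$ then $Df(\{x\})>0$, and if $Du(\{x\})<0$ then $Df(\{x\})<0$. -/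

import Mathlib

open MeasureTheory Set
open scoped ContDiff

/-- `φ ∈ C_c^∞((a,b))`. -/
structure IsTestFunction (a b : ℝ) (φ : ℝ → ℝ) : Prop where
  smooth : ContDiff ℝ ∞ φ
  compactSupport : HasCompactSupport φ
  support_subset : tsupport φ ⊆ Ioo a b

/-- `u ∈ BV((a,b))` with distributional derivative `Du = μ`: the function `u` is in `L¹((a,b))` and
`∫_a^b u φ' dx = - ∫ φ dμ` for all `φ ∈ C_c^∞((a,b))`, where `μ` is a finite signed Radon measure
on `(a,b)`, represented as a signed measure on `ℝ` that does not charge the complement of `(a,b)`.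
Such a `μ` is uniquely determined by `u`; the values of `u` outside `(a,b)` play no role. -/
structure HasBVDeriv (a b : ℝ) (u : ℝ → ℝ) (μ : SignedMeasure ℝ) : Prop where
  integrableOn : IntegrableOn u (Ioo a b)
  concentrated : μ.totalVariation (Ioo a b)ᶜ = 0
  integral_mul_deriv : ∀ φ : ℝ → ℝ, IsTestFunction a b φ →
    ∫ x in Ioo a b, u x * deriv φ x = -∫ᵛ x, φ x ∂•μ

/-- `g ∈ L¹((a,b))` is the weak derivative of `v` on `(a,b)`. -/
structure HasWeakDeriv (a b : ℝ) (v g : ℝ → ℝ) : Prop where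
  integrableOn : IntegrableOn v (Ioo a b)
  integrableOn_deriv : IntegrableOn g (Ioo a b)
  integral_mul_deriv : ∀ φ : ℝ → ℝ, IsTestFunction a b φ →
    ∫ x in Ioo a b, v x * deriv φ x = -∫ x in Ioo a b, g x * φ x

/-- The functional `½ ∫_a^b (f - u)² dx + ∫_(a,b) α d|μ|`, to be used with `μ = Du`. -/
noncomputable def weightedTVEnergy (a b : ℝ) (α f u : ℝ → ℝ) (μ : SignedMeasure ℝ) : ℝ :=
  1 / 2 * (∫ x in Ioo a b, (f x - u x) ^ 2) + ∫ x in Ioo a b, α x ∂μ.totalVariation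

/-- `u ∈ BV((a,b))`, with derivative `Du`, minimises `½ ∫ (f - w)² dx + ∫ α d|Dw|` over all
`w ∈ BV((a,b))`. -/
structure IsWeightedTVSolution (a b : ℝ) (α f u : ℝ → ℝ) (Du : SignedMeasure ℝ) : Prop where
  hasBVDeriv : HasBVDeriv a b u Du
  minimal : ∀ (w : ℝ → ℝ) (Dw : SignedMeasure ℝ), HasBVDeriv a b w Dw →
    weightedTVEnergy a b α f u Du ≤ weightedTVEnergy a b α f w Dw

/-! Let `Du {x} > 0`. For `0 < s ≤ Du {x}`, shift height `s` of the jump from `x` to a point `c`,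
that is, add `s (1_{(c,∞)} - 1_{(x,∞)})` to `u`. The weighted variation grows by at most `s (α c - α
x)`, and the fidelity changes by `-s ∫_c^x (f - u)` plus a term of order `s²`. Minimality and `s →
0` give `∫_c^x (f - u) ≤ α c - α x` (`IsWeightedTVSolution.integral_sub_le`).

Adding the cases `c = x - ε` and `c = x + ε` bounds the difference of the integrals of `f - u` left
and right of `x` by the second difference of `α`, which is a similar difference for `α'`
(`HasWeakDeriv.sub_eq_integral`). After division by `ε`, both sides converge to atoms at `x`
(`HasBVDeriv.tendsto_means_sub`), whence `Du {x} - Df {x} ≤ Dα' {x} = 0`. Negative jumps follow by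
changing the signs of `f` and `u`.

No good representatives are chosen: traces enter only through means over short intervals, obtained
by testing with differences of ramps. -/

open Filter Topology

/-! ### Piecewise linear ramps as limits of test functions. -/

/-- A smooth version of `t ↦ max t 0`: the primitive of `Real.smoothTransition`. -/
noncomputable def smoothRamp (t : ℝ) : ℝ := ∫ s in (0 : ℝ)..t, Real.smoothTransition s

lemma hasDerivAt_smoothRamp (t : ℝ) :
    HasDerivAt smoothRamp (Real.smoothTransition t) t :=
  intervalIntegral.integral_hasDerivAt_right
    (Real.smoothTransition.continuous.intervalIntegrable _ _)
    (Real.smoothTransition.continuous.stronglyMeasurableAtFilter _ _)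
    Real.smoothTransition.continuousAt

lemma contDiff_smoothRamp : ContDiff ℝ ∞ smoothRamp := by
  rw [contDiff_infty_iff_deriv]
  refine ⟨fun t ↦ (hasDerivAt_smoothRamp t).differentiableAt, ?_⟩
  have : deriv smoothRamp = Real.smoothTransition :=
    funext fun t ↦ (hasDerivAt_smoothRamp t).deriv
  rw [this]
  exact Real.smoothTransition.contDiff

lemma smoothRamp_of_nonpos {t : ℝ} (ht : t ≤ 0) : smoothRamp t = 0 := by
  rw [smoothRamp, intervalIntegral.integral_congr (g := fun _ ↦ (0 : ℝ))]
  · simp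
  · intro s hs
    rw [uIcc_of_ge ht] at hs
    exact Real.smoothTransition.zero_of_nonpos hs.2

lemma smoothRamp_of_one_le {t : ℝ} (ht : 1 ≤ t) : smoothRamp t = t - 1 + smoothRamp 1 := by
  have hi : ∀ c d : ℝ, IntervalIntegrable Real.smoothTransition volume c d := fun c d ↦
    Real.smoothTransition.continuous.intervalIntegrable _ _
  have h : ∫ s in (1 : ℝ)..t, Real.smoothTransition s = t - 1 := by
    rw [intervalIntegral.integral_congr (g := fun _ ↦ (1 : ℝ))]
    · simp
    · intro s hs
      rw [uIcc_of_le ht] at hs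
      exact Real.smoothTransition.one_of_one_le hs.1
  rw [smoothRamp, smoothRamp, ← intervalIntegral.integral_add_adjacent_intervals (hi 0 1) (hi 1 t),
    h, add_comm]

/-- A bound uniform in `t`, so that `smoothRamp (k * t) / k` is within `1 / k` of `max t 0`. -/
lemma abs_smoothRamp_sub_le (t : ℝ) : |smoothRamp t - max t 0| ≤ 1 := by
  have key : ∀ r : ℝ, 0 ≤ r → 0 ≤ smoothRamp r ∧ smoothRamp r ≤ r := by
    intro r hr
    constructor
    · exact intervalIntegral.integral_nonneg hr fun s _ ↦ Real.smoothTransition.nonneg s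
    · have := intervalIntegral.integral_mono_on (μ := volume) hr
        (Real.smoothTransition.continuous.intervalIntegrable 0 r)
        (continuous_const.intervalIntegrable (0 : ℝ) r)
        fun s _ ↦ Real.smoothTransition.le_one s
      simpa [smoothRamp] using this
  rcases le_total t 0 with h | h
  · simp [smoothRamp_of_nonpos h, h]
  · rw [max_eq_left h, abs_le]
    rcases le_total t 1 with h1 | h1
    · have := key t h
      constructor <;> linarith
    · have := key 1 zero_le_one
      rw [smoothRamp_of_one_le h1]
      constructor <;> linarith

/-- The linear ramp from `0` at `c` to `1` at `c + δ`. -/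
noncomputable def ramp (c δ t : ℝ) : ℝ := (max (t - c) 0 - max (t - (c + δ)) 0) / δ

lemma ramp_nonneg {δ : ℝ} (hδ : 0 < δ) (c t : ℝ) : 0 ≤ ramp c δ t := by
  refine div_nonneg (sub_nonneg.2 (max_le_max_right _ ?_)) hδ.le
  linarith

lemma ramp_le_one {δ : ℝ} (hδ : 0 < δ) (c t : ℝ) : ramp c δ t ≤ 1 := by
  rw [ramp, div_le_one hδ]
  rcases le_total (t - c) 0 with h | h
  · rw [max_eq_right h]
    linarith [le_max_right (t - (c + δ)) 0]
  · rw [max_eq_left h]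
    linarith [le_max_left (t - (c + δ)) 0]

lemma continuous_ramp (c δ : ℝ) : Continuous (ramp c δ) := by
  unfold ramp
  fun_prop

lemma ramp_of_le {c δ t : ℝ} (hδ : 0 < δ) (ht : t ≤ c) : ramp c δ t = 0 := by
  rw [ramp, max_eq_right (by linarith), max_eq_right (by linarith)]
  simp

lemma ramp_of_ge {c δ t : ℝ} (hδ : 0 < δ) (ht : c + δ ≤ t) : ramp c δ t = 1 := by
  rw [ramp, max_eq_left (by linarith), max_eq_left (by linarith)]
  field_simp
  ring

lemma tendsto_ramp (c t : ℝ) :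
    Tendsto (fun δ ↦ ramp c δ t) (𝓝[>] 0) (𝓝 ((Ioi c).indicator (fun _ ↦ 1) t)) := by
  by_cases h : c < t
  · rw [indicator_of_mem (mem_Ioi.2 h)]
    refine tendsto_const_nhds.congr' ?_
    filter_upwards [Ioo_mem_nhdsGT (sub_pos.2 h)] with δ hδ
    exact (ramp_of_ge hδ.1 (by linarith [hδ.2])).symm
  · rw [indicator_of_notMem (by simpa using h)]
    refine tendsto_const_nhds.congr' ?_
    filter_upwards [self_mem_nhdsWithin] with δ hδ
    exact (ramp_of_le hδ (not_lt.1 h)).symm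

/-- The difference of two ramps is a bounded pointwise limit of test functions whose derivatives
converge boundedly as well. -/
lemma exists_testFunction_tendsto_ramp_sub {a b c d δ : ℝ} (hδ : 0 < δ) (hac : a < c)
    (hcb : c + δ < b) (had : a < d) (hdb : d + δ < b) :
    ∃ (φ : ℕ → ℝ → ℝ) (C : ℝ), (∀ n, IsTestFunction a b (φ n)) ∧ (∀ n t, |φ n t| ≤ C) ∧
      (∀ n t, |deriv (φ n) t| ≤ C) ∧
      (∀ t, Tendsto (fun n ↦ φ n t) atTop (𝓝 (ramp c δ t - ramp d δ t))) ∧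
      ∀ t, Tendsto (fun n ↦ deriv (φ n) t) atTop
        (𝓝 (δ⁻¹ * (((Ioi c).indicator (fun _ ↦ 1) t - (Ioi (c + δ)).indicator (fun _ ↦ 1) t) -
          ((Ioi d).indicator (fun _ ↦ 1) t - (Ioi (d + δ)).indicator (fun _ ↦ 1) t)))) := by
  set m := max (c + δ) (d + δ) with hm
  have hmb : m < b := max_lt hcb hdb
  -- Smoothing at scale `1 / k` widens the support to the right by `1 / k`; the offset `N` keeps it
  -- inside `(a, b)` for every `n`.
  obtain ⟨N, hN⟩ := exists_nat_one_div_lt (sub_pos.2 hmb)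
  set k : ℕ → ℝ := fun n ↦ (n : ℝ) + N + 1 with hk
  have hk0 : ∀ n, 0 < k n := fun n ↦ by simp only [hk]; positivity
  have hk1 : ∀ n, 1 ≤ k n := fun n ↦ by
    simp only [hk]
    have : (0 : ℝ) ≤ n := n.cast_nonneg
    have : (0 : ℝ) ≤ N := N.cast_nonneg
    linarith
  have hkN : ∀ n, 1 / k n ≤ 1 / ((N : ℝ) + 1) := fun n ↦ by
    apply one_div_le_one_div_of_le (by positivity)
    simp only [hk]
    have : (0 : ℝ) ≤ n := n.cast_nonneg
    linarith
  have hk_top : Tendsto k atTop atTop := by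
    simp only [hk]
    exact tendsto_atTop_add_const_right _ _ (tendsto_atTop_add_const_right _ _
      tendsto_natCast_atTop_atTop)
  have hk_inv : Tendsto (fun n ↦ 1 / k n) atTop (𝓝 0) := by
    simpa only [one_div] using! hk_top.inv_tendsto_atTop
  let S : ℕ → ℝ → ℝ := fun n t ↦ smoothRamp (k n * t) / k n
  have hS_deriv : ∀ n t, HasDerivAt (S n) (Real.smoothTransition (k n * t)) t := by
    intro n t
    have h1 : HasDerivAt (fun t ↦ k n * t) (k n) t := by
      simpa using (hasDerivAt_id t).const_mul (k n)
    have := ((hasDerivAt_smoothRamp (k n * t)).comp t h1).div_const (k n)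
    rwa [mul_div_assoc, div_self (hk0 n).ne', mul_one] at this
  have hS_smooth : ∀ n, ContDiff ℝ ∞ (S n) := fun n ↦
    (contDiff_smoothRamp.comp (contDiff_const.mul contDiff_id)).div_const _
  have hS_abs : ∀ n t, |S n t - max t 0| ≤ 1 / k n := by
    intro n t
    have h := abs_smoothRamp_sub_le (k n * t)
    have h2 : max (k n * t) 0 = k n * max t 0 := by
      rw [mul_max_of_nonneg _ _ (hk0 n).le, mul_zero]
    have h3 : S n t - max t 0 = (smoothRamp (k n * t) - max (k n * t) 0) / k n := by
      rw [h2]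
      have := (hk0 n).ne'
      simp only [S]
      field_simp
    rw [h3, abs_div, abs_of_pos (hk0 n)]
    exact div_le_div_of_nonneg_right h (hk0 n).le
  have hS_tendsto : ∀ t, Tendsto (fun n ↦ S n t) atTop (𝓝 (max t 0)) := by
    intro t
    rw [tendsto_iff_norm_sub_tendsto_zero]
    exact squeeze_zero (fun _ ↦ norm_nonneg _) (fun n ↦ hS_abs n t) hk_inv
  have hS_zero : ∀ n t, t ≤ 0 → S n t = 0 := fun n t ht ↦ by
    simp only [S]
    rw [smoothRamp_of_nonpos (mul_nonpos_of_nonneg_of_nonpos (hk0 n).le ht), zero_div]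
  have hS_large : ∀ n t, 1 / k n ≤ t → S n t = t + (smoothRamp 1 - 1) / k n := fun n t ht ↦ by
    have : 1 ≤ k n * t := by rwa [div_le_iff₀' (hk0 n)] at ht
    simp only [S]
    rw [smoothRamp_of_one_le this]
    have := (hk0 n).ne'
    field_simp
    ring
  -- `smoothTransition` vanishes at `0`, so the limit at `t = c` is `0`: the ray is open.
  have hs_tendsto : ∀ c t, Tendsto (fun n ↦ Real.smoothTransition (k n * (t - c))) atTop
      (𝓝 ((Ioi c).indicator (fun _ ↦ 1) t)) := by
    intro c t
    by_cases h : c < t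
    · rw [indicator_of_mem (mem_Ioi.2 h)]
      refine tendsto_const_nhds.congr' ?_
      filter_upwards [hk_top.eventually_ge_atTop (1 / (t - c))] with n hn
      rw [div_le_iff₀ (sub_pos.2 h)] at hn
      exact (Real.smoothTransition.one_of_one_le hn).symm
    · rw [indicator_of_notMem (by simpa using h)]
      refine tendsto_const_nhds.congr fun n ↦ ?_
      exact (Real.smoothTransition.zero_of_nonpos (mul_nonpos_of_nonneg_of_nonpos (hk0 n).le
        (by linarith [not_lt.1 h]))).symm
  let φ : ℕ → ℝ → ℝ := fun n t ↦
    δ⁻¹ * ((S n (t - c) - S n (t - (c + δ))) - (S n (t - d) - S n (t - (d + δ))))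
  have hφ_deriv : ∀ n t, deriv (φ n) t = δ⁻¹ * ((Real.smoothTransition (k n * (t - c)) -
      Real.smoothTransition (k n * (t - (c + δ)))) - (Real.smoothTransition (k n * (t - d)) -
      Real.smoothTransition (k n * (t - (d + δ))))) := by
    intro n t
    have hc : ∀ e, HasDerivAt (fun t ↦ S n (t - e)) (Real.smoothTransition (k n * (t - e))) t :=
      fun e ↦ (hS_deriv n (t - e)).comp_sub_const t e
    exact ((((hc c).sub (hc _)).sub ((hc d).sub (hc _))).const_mul δ⁻¹).deriv
  have hφ_tendsto : ∀ t, Tendsto (fun n ↦ φ n t) atTop (𝓝 (ramp c δ t - ramp d δ t)) := by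
    intro t
    have : ramp c δ t - ramp d δ t = δ⁻¹ * ((max (t - c) 0 - max (t - (c + δ)) 0) -
        (max (t - d) 0 - max (t - (d + δ)) 0)) := by
      simp only [ramp]
      ring
    rw [this]
    exact (((hS_tendsto _).sub (hS_tendsto _)).sub
      ((hS_tendsto _).sub (hS_tendsto _))).const_mul _
  have hφ_near : ∀ n t, |φ n t| ≤ 1 + 4 * δ⁻¹ := by
    intro n t
    have hr : |ramp c δ t - ramp d δ t| ≤ 1 := by
      rw [abs_le]
      constructor <;> linarith [ramp_nonneg hδ c t, ramp_nonneg hδ d t, ramp_le_one hδ c t,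
        ramp_le_one hδ d t]
    have he : |φ n t - (ramp c δ t - ramp d δ t)| ≤ 4 * δ⁻¹ := by
      have : φ n t - (ramp c δ t - ramp d δ t) = δ⁻¹ *
          (((S n (t - c) - max (t - c) 0) - (S n (t - (c + δ)) - max (t - (c + δ)) 0)) -
          ((S n (t - d) - max (t - d) 0) - (S n (t - (d + δ)) - max (t - (d + δ)) 0))) := by
        simp only [ramp, φ]
        ring
      rw [this, abs_mul, abs_of_pos (inv_pos.2 hδ), mul_comm]
      refine mul_le_mul_of_nonneg_right ?_ (inv_pos.2 hδ).le
      have hle : ∀ s, |S n s - max s 0| ≤ 1 := fun s ↦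
        (hS_abs n s).trans ((div_le_one (hk0 n)).2 (hk1 n))
      have h1 := abs_le.1 (hle (t - c))
      have h2 := abs_le.1 (hle (t - (c + δ)))
      have h3 := abs_le.1 (hle (t - d))
      have h4 := abs_le.1 (hle (t - (d + δ)))
      rw [abs_le]
      constructor <;> linarith [h1.1, h1.2, h2.1, h2.2, h3.1, h3.2, h4.1, h4.2]
    calc |φ n t| = |(ramp c δ t - ramp d δ t) + (φ n t - (ramp c δ t - ramp d δ t))| := by
          congr 1; ring
      _ ≤ _ := (abs_add_le _ _).trans (add_le_add hr he)
  have hφ_supp : ∀ n, Function.support (φ n) ⊆ Icc (min c d) (m + 1 / k n) := by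
    intro n t ht
    by_contra hmem
    refine ht ?_
    rw [mem_Icc, not_and_or, not_le, not_le] at hmem
    rcases hmem with h | h
    · rw [lt_min_iff] at h
      simp only [φ]
      rw [hS_zero _ _ (by linarith), hS_zero _ _ (by linarith), hS_zero _ _ (by linarith),
        hS_zero _ _ (by linarith)]
      simp
    -- Past all four corners each `S n` is affine with the same constant, so the alternating sum
    -- cancels.
    · have h1 := le_max_left (c + δ) (d + δ)
      have h2 := le_max_right (c + δ) (d + δ)
      simp only [φ]
      rw [hS_large _ _ (by linarith), hS_large _ _ (by linarith), hS_large _ _ (by linarith),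
        hS_large _ _ (by linarith)]
      ring
  refine ⟨φ, 1 + 4 * δ⁻¹, fun n ↦ ⟨?_, ?_, ?_⟩, hφ_near, ?_, hφ_tendsto, ?_⟩
  · have hc : ∀ e, ContDiff ℝ ∞ (fun t ↦ S n (t - e)) := fun e ↦
      (hS_smooth n).comp (contDiff_id.sub contDiff_const)
    exact contDiff_const.mul (((hc c).sub (hc _)).sub ((hc d).sub (hc _)))
  · exact HasCompactSupport.of_support_subset_isCompact isCompact_Icc (hφ_supp n)
  · refine (closure_minimal (hφ_supp n) isClosed_Icc).trans fun t ht ↦ ⟨?_, ?_⟩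
    · exact (lt_min hac had).trans_le ht.1
    · linarith [ht.2, hkN n]
  · intro n t
    rw [hφ_deriv, abs_mul, abs_of_pos (inv_pos.2 hδ)]
    have h0 := fun s ↦ Real.smoothTransition.nonneg s
    have h1 := fun s ↦ Real.smoothTransition.le_one s
    have : |(Real.smoothTransition (k n * (t - c)) -
      Real.smoothTransition (k n * (t - (c + δ)))) - (Real.smoothTransition (k n * (t - d)) -
      Real.smoothTransition (k n * (t - (d + δ))))| ≤ 4 := by
      rw [abs_le]
      constructor <;> linarith [h0 (k n * (t - c)), h0 (k n * (t - (c + δ))), h0 (k n * (t - d)),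
        h0 (k n * (t - (d + δ))), h1 (k n * (t - c)), h1 (k n * (t - (c + δ))), h1 (k n * (t - d)),
        h1 (k n * (t - (d + δ)))]
    nlinarith [inv_pos.2 hδ]
  · intro t
    simp only [hφ_deriv]
    exact (((hs_tendsto _ _).sub (hs_tendsto _ _)).sub
      ((hs_tendsto _ _).sub (hs_tendsto _ _))).const_mul _

/-! ### Means, primitives and boundedness by testing with ramps. -/

section Traces

instance SignedMeasure.isFiniteMeasure_variation {X : Type*} [MeasurableSpace X]
    (μ : SignedMeasure X) : IsFiniteMeasure μ.variation := by
  rw [← μ.totalVariation_eq_variation]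
  infer_instance

section IntervalIntegrals

variable {a b c d : ℝ} {v : ℝ → ℝ}

lemma MeasureTheory.IntegrableOn.intervalIntegrable_of_mem_Ioo (hv : IntegrableOn v (Ioo a b))
    (hc : c ∈ Ioo a b) (hd : d ∈ Ioo a b) : IntervalIntegrable v volume c d :=
  (hv.mono_set (ordConnected_Ioo.uIcc_subset hc hd)).intervalIntegrable

lemma setIntegral_Ioo_mul_indicator_Ioi (hc : a ≤ c) (hcb : c ≤ b) :
    ∫ t in Ioo a b, v t * (Ioi c).indicator (fun _ ↦ 1) t = ∫ t in c..b, v t := by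
  have h : ∀ t, v t * (Ioi c).indicator (fun _ ↦ 1) t = (Ioi c).indicator v t := fun t ↦ by
    by_cases ht : t ∈ Ioi c <;> simp [ht]
  simp only [h]
  rw [setIntegral_indicator measurableSet_Ioi, Ioo_inter_Ioi, max_eq_right hc,
    intervalIntegral.integral_of_le hcb, integral_Ioc_eq_integral_Ioo]

lemma MeasureTheory.IntegrableOn.mul_indicator_Ioi (hv : IntegrableOn v (Ioo a b)) (c : ℝ) :
    IntegrableOn (fun t ↦ v t * (Ioi c).indicator (fun _ ↦ 1) t) (Ioo a b) := by
  have h : (fun t ↦ v t * (Ioi c).indicator (fun _ ↦ 1) t) = (Ioi c).indicator v := by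
    ext t
    by_cases ht : t ∈ Ioi c <;> simp [ht]
  rw [h]
  exact hv.indicator measurableSet_Ioi

lemma setIntegral_Ioo_mul_indicator_Ioi_sub (hv : IntegrableOn v (Ioo a b))
    (hc : c ∈ Ioo a b) (hd : d ∈ Ioo a b) :
    ∫ t in Ioo a b, v t * ((Ioi c).indicator (fun _ ↦ 1) t - (Ioi d).indicator (fun _ ↦ 1) t) =
      ∫ t in c..d, v t := by
  simp only [mul_sub]
  rw [integral_sub (hv.mul_indicator_Ioi c) (hv.mul_indicator_Ioi d),
    setIntegral_Ioo_mul_indicator_Ioi hc.1.le hc.2.le,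
    setIntegral_Ioo_mul_indicator_Ioi hd.1.le hd.2.le]
  have hdb : IntervalIntegrable v volume d b := by
    rw [intervalIntegrable_iff_integrableOn_Ioo_of_le hd.2.le]
    exact hv.mono_set (Ioo_subset_Ioo_left hd.1.le)
  rw [← intervalIntegral.integral_add_adjacent_intervals (hv.intervalIntegrable_of_mem_Ioo hc hd)
    hdb, add_sub_cancel_right]

lemma tendsto_setIntegral_mul_of_bounded {v : ℝ → ℝ} {s : Set ℝ} (hv : IntegrableOn v s)
    {F : ℕ → ℝ → ℝ} {G : ℝ → ℝ} {C : ℝ} (hF : ∀ n, Measurable (F n)) (hC : ∀ n t, |F n t| ≤ C)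
    (hG : ∀ t, Tendsto (fun n ↦ F n t) atTop (𝓝 (G t))) :
    Tendsto (fun n ↦ ∫ t in s, v t * F n t) atTop (𝓝 (∫ t in s, v t * G t)) := by
  refine tendsto_integral_of_dominated_convergence (fun t ↦ ‖v t‖ * C)
    (fun n ↦ hv.aestronglyMeasurable.mul (hF n).aestronglyMeasurable) (hv.norm.mul_const C)
    (fun n ↦ .of_forall fun t ↦ ?_) (.of_forall fun t ↦ (hG t).const_mul _)
  rw [norm_mul]
  exact mul_le_mul_of_nonneg_left (hC n t) (norm_nonneg _)

end IntervalIntegrals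

variable {a b c d δ x : ℝ} {v g : ℝ → ℝ} {μ : SignedMeasure ℝ}

/-- The factor of `v t` is the derivative of `ramp c δ - ramp d δ` away from the corners. -/
lemma setIntegral_mul_ramp_slopes (hv : IntegrableOn v (Ioo a b)) (hδ : 0 < δ) (hac : a < c)
    (hcb : c + δ < b) (had : a < d) (hdb : d + δ < b) :
    ∫ t in Ioo a b, v t *
      (δ⁻¹ * (((Ioi c).indicator (fun _ ↦ 1) t - (Ioi (c + δ)).indicator (fun _ ↦ 1) t) -
        ((Ioi d).indicator (fun _ ↦ 1) t - (Ioi (d + δ)).indicator (fun _ ↦ 1) t))) =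
      δ⁻¹ * ((∫ t in c..(c + δ), v t) - ∫ t in d..(d + δ), v t) := by
  have hi := fun e ↦ hv.mul_indicator_Ioi e
  rw [← setIntegral_Ioo_mul_indicator_Ioi_sub hv ⟨hac, by linarith⟩ ⟨by linarith, hcb⟩,
    ← setIntegral_Ioo_mul_indicator_Ioi_sub hv ⟨had, by linarith⟩ ⟨by linarith, hdb⟩,
    ← integral_sub, ← integral_const_mul]
  · congr 1
    ext t
    ring
  · simp only [mul_sub]
    exact (hi c).sub (hi (c + δ))
  · simp only [mul_sub]
    exact (hi d).sub (hi (d + δ))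

/-- Integration by parts passes to the limit by dominated convergence. A difference is needed
because a single ramp does not vanish near `b`. -/
lemma HasBVDeriv.integral_ramp_sub (hv : HasBVDeriv a b v μ) (hδ : 0 < δ) (hac : a < c)
    (hcb : c + δ < b) (had : a < d) (hdb : d + δ < b) :
    δ⁻¹ * ((∫ t in c..(c + δ), v t) - ∫ t in d..(d + δ), v t) =
      -∫ᵛ t, (ramp c δ t - ramp d δ t) ∂•μ := by
  obtain ⟨φ, C, hφ, hC, hC', hlim, hlim'⟩ :=
    exists_testFunction_tendsto_ramp_sub hδ hac hcb had hdb
  have h1 := tendsto_setIntegral_mul_of_bounded hv.integrableOn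
    (fun n ↦ measurable_deriv (φ n)) hC' hlim'
  rw [setIntegral_mul_ramp_slopes hv.integrableOn hδ hac hcb had hdb] at h1
  have h2 : Tendsto (fun n ↦ ∫ᵛ t, φ n t ∂•μ) atTop
      (𝓝 (∫ᵛ t, (ramp c δ t - ramp d δ t) ∂•μ)) :=
    VectorMeasure.tendsto_integral_filter_of_norm_le_const
      (.of_forall fun n ↦ (hφ n).smooth.continuous.aestronglyMeasurable)
      ⟨C, .of_forall fun n ↦ .of_forall fun t ↦ hC n t⟩ (.of_forall hlim)
  refine tendsto_nhds_unique h1 (h2.neg.congr fun n ↦ ?_)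
  exact (hv.integral_mul_deriv _ (hφ n)).symm

lemma HasWeakDeriv.integral_ramp_sub (hv : HasWeakDeriv a b v g) (hδ : 0 < δ) (hac : a < c)
    (hcb : c + δ < b) (had : a < d) (hdb : d + δ < b) :
    δ⁻¹ * ((∫ t in c..(c + δ), v t) - ∫ t in d..(d + δ), v t) =
      -∫ t in Ioo a b, g t * (ramp c δ t - ramp d δ t) := by
  obtain ⟨φ, C, hφ, hC, hC', hlim, hlim'⟩ :=
    exists_testFunction_tendsto_ramp_sub hδ hac hcb had hdb
  have h1 := tendsto_setIntegral_mul_of_bounded hv.integrableOn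
    (fun n ↦ measurable_deriv (φ n)) hC' hlim'
  rw [setIntegral_mul_ramp_slopes hv.integrableOn hδ hac hcb had hdb] at h1
  have h2 := tendsto_setIntegral_mul_of_bounded hv.integrableOn_deriv
    (fun n ↦ (hφ n).smooth.continuous.measurable) hC hlim
  refine tendsto_nhds_unique h1 (h2.neg.congr fun n ↦ ?_)
  exact (hv.integral_mul_deriv _ (hφ n)).symm

lemma abs_ramp_sub_le (hδ : 0 < δ) (t : ℝ) : |ramp c δ t - ramp d δ t| ≤ 1 := by
  rw [abs_le]
  constructor <;> linarith [ramp_nonneg hδ c t, ramp_nonneg hδ d t, ramp_le_one hδ c t,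
    ramp_le_one hδ d t]

/-- The difference is the tent of height `1` on `[x - ε, x + ε]`, which shrinks to its peak. -/
lemma tendsto_ramp_sub_ramp_self (x t : ℝ) :
    Tendsto (fun ε ↦ ramp (x - ε) ε t - ramp x ε t) (𝓝[>] 0)
      (𝓝 (({x} : Set ℝ).indicator (fun _ ↦ 1) t)) := by
  rcases lt_trichotomy t x with h | rfl | h
  · rw [indicator_of_notMem (by simpa using h.ne)]
    refine tendsto_const_nhds.congr' ?_
    filter_upwards [Ioo_mem_nhdsGT (sub_pos.2 h)] with ε hε
    rw [ramp_of_le hε.1 (by linarith [hε.2]), ramp_of_le hε.1 h.le, sub_zero]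
  · rw [indicator_of_mem (mem_singleton t)]
    refine tendsto_const_nhds.congr' ?_
    filter_upwards [self_mem_nhdsWithin] with ε hε
    rw [ramp_of_ge hε (by linarith), ramp_of_le hε le_rfl, sub_zero]
  · rw [indicator_of_notMem (by simpa using h.ne')]
    refine tendsto_const_nhds.congr' ?_
    filter_upwards [Ioo_mem_nhdsGT (sub_pos.2 h)] with ε hε
    rw [ramp_of_ge hε.1 (by linarith [hε.2]), ramp_of_ge hε.1 (by linarith [hε.2]), sub_self]

lemma integral_indicator_singleton (μ : SignedMeasure ℝ) (x : ℝ) :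
    ∫ᵛ t, ({x} : Set ℝ).indicator (fun _ ↦ (1 : ℝ)) t ∂•μ = μ {x} := by
  rw [VectorMeasure.integral_indicator (measurableSet_singleton x), VectorMeasure.integral_const]
  simp

/-- The jump of a `BV` function at `x` is the limit of the difference of its one-sided means. -/
lemma HasBVDeriv.tendsto_means_sub (hv : HasBVDeriv a b v μ) (hx : x ∈ Ioo a b) :
    Tendsto (fun ε ↦ ε⁻¹ * ((∫ t in (x - ε)..x, v t) - ∫ t in x..(x + ε), v t)) (𝓝[>] 0)
      (𝓝 (-μ {x})) := by
  have h : Tendsto (fun ε ↦ ∫ᵛ t, (ramp (x - ε) ε t - ramp x ε t) ∂•μ) (𝓝[>] 0)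
      (𝓝 (∫ᵛ t, ({x} : Set ℝ).indicator (fun _ ↦ (1 : ℝ)) t ∂•μ)) := by
    refine VectorMeasure.tendsto_integral_filter_of_norm_le_const
      (.of_forall fun ε ↦ ?_) ⟨1, ?_⟩ (.of_forall (tendsto_ramp_sub_ramp_self x))
    · exact ((continuous_ramp _ _).sub (continuous_ramp _ _)).aestronglyMeasurable
    · filter_upwards [self_mem_nhdsWithin] with ε hε
      exact .of_forall fun t ↦ abs_ramp_sub_le hε t
  rw [integral_indicator_singleton] at h
  refine h.neg.congr' ?_
  filter_upwards [Ioo_mem_nhdsGT (sub_pos.2 hx.1), Ioo_mem_nhdsGT (sub_pos.2 hx.2)] with ε h1 h2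
  rw [← hv.integral_ramp_sub h1.1 (by linarith [h1.2]) (by linarith [hx.2]) hx.1
    (by linarith [h2.2]), sub_add_cancel]

/-- A continuous function is the primitive of its weak derivative. -/
lemma HasWeakDeriv.sub_eq_integral (hv : HasWeakDeriv a b v g) (hcont : ContinuousOn v (Ioo a b))
    (hc : c ∈ Ioo a b) (hd : d ∈ Ioo a b) : v d - v c = ∫ t in c..d, g t := by
  have hmean : ∀ e ∈ Ioo a b,
      Tendsto (fun δ ↦ δ⁻¹ * ∫ t in e..(e + δ), v t) (𝓝[>] 0) (𝓝 (v e)) := by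
    intro e he
    have hd : HasDerivAt (fun y ↦ ∫ t in e..y, v t) (v e) e :=
      intervalIntegral.integral_hasDerivAt_right IntervalIntegrable.refl
        (hcont.stronglyMeasurableAtFilter isOpen_Ioo _ he)
        (hcont.continuousAt (isOpen_Ioo.mem_nhds he))
    simpa using hd.tendsto_slope_zero_right
  have h1 : Tendsto (fun δ ↦ δ⁻¹ * ((∫ t in c..(c + δ), v t) - ∫ t in d..(d + δ), v t)) (𝓝[>] 0)
      (𝓝 (v c - v d)) := by
    simpa only [mul_sub] using (hmean c hc).sub (hmean d hd)
  -- As `δ → 0` the ramps become unit steps at `c` and `d`.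
  have h2 : Tendsto (fun δ ↦ ∫ t in Ioo a b, g t * (ramp c δ t - ramp d δ t)) (𝓝[>] 0)
      (𝓝 (∫ t in Ioo a b,
        g t * ((Ioi c).indicator (fun _ ↦ 1) t - (Ioi d).indicator (fun _ ↦ 1) t))) := by
    refine tendsto_integral_filter_of_dominated_convergence (fun t ↦ ‖g t‖) (.of_forall fun δ ↦ ?_)
      ?_ hv.integrableOn_deriv.norm
      (.of_forall fun t ↦ ((tendsto_ramp c t).sub (tendsto_ramp d t)).const_mul _)
    · exact hv.integrableOn_deriv.aestronglyMeasurable.mul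
        ((continuous_ramp _ _).sub (continuous_ramp _ _)).aestronglyMeasurable
    · filter_upwards [self_mem_nhdsWithin] with δ hδ
      refine .of_forall fun t ↦ ?_
      rw [norm_mul]
      exact mul_le_of_le_one_right (norm_nonneg _) (abs_ramp_sub_le hδ t)
  rw [setIntegral_Ioo_mul_indicator_Ioi_sub hv.integrableOn_deriv hc hd] at h2
  have h3 := tendsto_nhds_unique h1 (h2.neg.congr' ?_)
  · linarith
  · filter_upwards [Ioo_mem_nhdsGT (sub_pos.2 hc.2), Ioo_mem_nhdsGT (sub_pos.2 hd.2)] with δ k1 k2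
    exact (hv.integral_ramp_sub k1.1 hc.1 (by linarith [k1.2]) hd.1 (by linarith [k2.2])).symm

/-- At points where forward means converge to `v`, two values differ by at most the total mass of
`μ`; one such point `z` is fixed. This makes `f - u` square integrable. -/
lemma HasBVDeriv.exists_ae_abs_le (hv : HasBVDeriv a b v μ) :
    ∃ C, ∀ᵐ t ∂volume.restrict (Ioo a b), |v t| ≤ C := by
  rcases le_or_gt b a with hba | hab
  · exact ⟨0, by simp [Ioo_eq_empty (not_lt.2 hba)]⟩
  have hint : IntervalIntegrable v volume a b := by
    rw [intervalIntegrable_iff_integrableOn_Ioo_of_le hab.le]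
    exact hv.integrableOn
  have hmean : ∀ᵐ t ∂volume.restrict (Ioo a b), t ∈ Ioo a b ∧
      Tendsto (fun δ ↦ δ⁻¹ * ∫ s in t..(t + δ), v s) (𝓝[>] 0) (𝓝 (v t)) := by
    rw [ae_restrict_iff' measurableSet_Ioo]
    filter_upwards [hint.ae_hasDerivAt_integral] with t ht hmem
    have hmem' : t ∈ uIcc a b := by
      rw [uIcc_of_le hab.le]
      exact Ioo_subset_Icc_self hmem
    refine ⟨hmem, ?_⟩
    simpa using (ht hmem' t hmem').tendsto_slope_zero_right
  have : (ae (volume.restrict (Ioo a b))).NeBot := by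
    rw [ae_neBot, Ne, Measure.restrict_eq_zero]
    simp [hab]
  obtain ⟨z, hz, hzlim⟩ := hmean.exists
  set K := μ.variation.real univ
  refine ⟨|v z| + K, ?_⟩
  filter_upwards [hmean] with t ht
  have hlim : Tendsto
      (fun δ ↦ |δ⁻¹ * ((∫ s in t..(t + δ), v s) - ∫ s in z..(z + δ), v s)|) (𝓝[>] 0)
      (𝓝 |v t - v z|) := by
    simpa only [mul_sub] using (ht.2.sub hzlim).abs
  have hle : |v t - v z| ≤ K := by
    refine le_of_tendsto hlim ?_
    filter_upwards [Ioo_mem_nhdsGT (sub_pos.2 ht.1.2), Ioo_mem_nhdsGT (sub_pos.2 hz.2)]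
      with δ k1 k2
    rw [hv.integral_ramp_sub k1.1 ht.1.1 (by linarith [k1.2]) hz.1 (by linarith [k2.2]), abs_neg]
    have h := VectorMeasure.norm_integral_le_of_norm_le_const (μ := μ)
      (B := ContinuousLinearMap.lsmul ℝ ℝ) (C := 1)
      (f := fun s ↦ ramp t δ s - ramp z δ s) (.of_forall fun s ↦ abs_ramp_sub_le k1.1 s)
    simpa [K] using h
  have := abs_sub_abs_le_abs_sub (v t) (v z)
  linarith

end Traces

/-! ### Algebra of `BV` functions and step functions as competitors. -/

section Optimality

variable {a b c x s : ℝ} {v w φ α f u : ℝ → ℝ} {μ ν : SignedMeasure ℝ}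

lemma IsTestFunction.continuous_deriv (hφ : IsTestFunction a b φ) : Continuous (deriv φ) :=
  hφ.smooth.continuous_deriv (by simp)

lemma IsTestFunction.integrable (hφ : IsTestFunction a b φ) (m : Measure ℝ) [IsFiniteMeasure m] :
    Integrable φ m :=
  hφ.smooth.continuous.integrable_of_hasCompactSupport hφ.compactSupport

lemma IsTestFunction.integrableOn_mul_deriv (hφ : IsTestFunction a b φ) {S : Set ℝ}
    (hv : IntegrableOn v S) : IntegrableOn (fun t ↦ v t * deriv φ t) S := by
  obtain ⟨C, hC⟩ := hφ.continuous_deriv.bounded_above_of_compact_support hφ.compactSupport.deriv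
  exact Integrable.mul_bdd (c := C) hv hφ.continuous_deriv.aestronglyMeasurable (.of_forall hC)

lemma IsTestFunction.eq_zero_of_notMem (hφ : IsTestFunction a b φ) {t : ℝ} (ht : t ∉ Ioo a b) :
    φ t = 0 :=
  image_eq_zero_of_notMem_tsupport fun h ↦ ht (hφ.support_subset h)

lemma HasBVDeriv.add (hv : HasBVDeriv a b v μ) (hw : HasBVDeriv a b w ν) :
    HasBVDeriv a b (fun t ↦ v t + w t) (μ + ν) where
  integrableOn := hv.integrableOn.add hw.integrableOn
  concentrated := by
    have h1 := hv.concentrated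
    have h2 := hw.concentrated
    rw [SignedMeasure.totalVariation_eq_variation] at *
    refine le_antisymm ((VectorMeasure.variation_add_le _).trans ?_) zero_le
    simp [h1, h2]
  integral_mul_deriv φ hφ := by
    simp only [add_mul]
    rw [integral_add (hφ.integrableOn_mul_deriv hv.integrableOn)
      (hφ.integrableOn_mul_deriv hw.integrableOn), hv.integral_mul_deriv φ hφ,
      hw.integral_mul_deriv φ hφ,
      VectorMeasure.integral_add_vectorMeasure (hφ.integrable _) (hφ.integrable _)]
    ring

lemma HasBVDeriv.const_mul (hv : HasBVDeriv a b v μ) (r : ℝ) :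
    HasBVDeriv a b (fun t ↦ r * v t) (r • μ) where
  integrableOn := hv.integrableOn.const_mul r
  concentrated := by
    have h1 := hv.concentrated
    rw [SignedMeasure.totalVariation_eq_variation] at *
    rw [VectorMeasure.variation_smul]
    simp [h1]
  integral_mul_deriv φ hφ := by
    simp only [mul_assoc]
    rw [integral_const_mul, hv.integral_mul_deriv φ hφ,
      VectorMeasure.integral_smul_vectorMeasure]
    simp

lemma HasBVDeriv.neg (hv : HasBVDeriv a b v μ) : HasBVDeriv a b (fun t ↦ -v t) (-μ) := by
  simpa only [neg_one_smul ℝ μ, neg_one_mul] using hv.const_mul (-1)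

lemma HasBVDeriv.sub (hv : HasBVDeriv a b v μ) (hw : HasBVDeriv a b w ν) :
    HasBVDeriv a b (fun t ↦ v t - w t) (μ - ν) := by
  simpa only [sub_eq_add_neg] using hv.add hw.neg

lemma hasBVDeriv_indicator_Ioi (hc : c ∈ Ioo a b) :
    HasBVDeriv a b ((Ioi c).indicator fun _ ↦ 1) (VectorMeasure.dirac c 1) where
  integrableOn := (integrableOn_const (by simp)).indicator measurableSet_Ioi
  concentrated := by
    rw [SignedMeasure.totalVariation_eq_variation, VectorMeasure.variation_dirac]
    simp only [Measure.smul_apply, Measure.dirac_apply' _ measurableSet_Ioo.compl]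
    simp [hc.1, hc.2]
  integral_mul_deriv φ hφ := by
    simp only [mul_comm _ (deriv φ _)]
    rw [setIntegral_Ioo_mul_indicator_Ioi hc.1.le hc.2.le,
      intervalIntegral.integral_deriv_eq_sub
        (fun t _ ↦ (hφ.smooth.differentiable (by simp)).differentiableAt)
        (hφ.continuous_deriv.intervalIntegrable _ _), hφ.eq_zero_of_notMem (by simp)]
    simp

lemma IsWeightedTVSolution.neg {Du : SignedMeasure ℝ} (hu : IsWeightedTVSolution a b α f u Du) :
    IsWeightedTVSolution a b α (fun t ↦ -f t) (fun t ↦ -u t) (-Du) where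
  hasBVDeriv := hu.hasBVDeriv.neg
  minimal w Dw hw := by
    have h := hu.minimal _ _ hw.neg
    have h1 : ∀ t, (f t - -w t) ^ 2 = (-f t - w t) ^ 2 := fun t ↦ by ring
    have h2 : ∀ t, (-f t - -u t) ^ 2 = (f t - u t) ^ 2 := fun t ↦ by ring
    simp only [weightedTVEnergy, SignedMeasure.totalVariation_neg, h1, h2] at *
    exact h

/-! ### Weighted variation after moving an atom. -/

lemma SignedMeasure.variation_singleton (μ : SignedMeasure ℝ) (x : ℝ) :
    μ.variation {x} = ‖μ {x}‖ₑ := by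
  have h := VectorMeasure.variation_restrict (μ := μ) (measurableSet_singleton x)
  have h2 : μ.restrict {x} = VectorMeasure.dirac x (μ {x}) := by
    ext E hE
    rw [VectorMeasure.restrict_apply _ (measurableSet_singleton x) hE]
    by_cases hx : x ∈ E
    · rw [inter_eq_self_of_subset_right (by simpa using hx),
        VectorMeasure.dirac_apply_of_mem hE hx]
    · rw [inter_singleton_eq_empty.2 hx, VectorMeasure.dirac_apply_of_notMem hx,
        VectorMeasure.empty]
  rw [h2, VectorMeasure.variation_dirac] at h
  have := congrArg (fun m : Measure ℝ ↦ m {x}) h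
  simpa using this.symm

/-- Moving a part `s` of a positive atom from `x` to `c` does not increase the total mass. -/
lemma SignedMeasure.variation_add_move_atom_le (hs : 0 ≤ s) (hsx : s ≤ μ {x}) (c : ℝ) :
    (μ + (s • VectorMeasure.dirac c 1 - s • VectorMeasure.dirac x 1) :
      SignedMeasure ℝ).variation ≤
      μ.variation.restrict {x}ᶜ + (ENNReal.ofReal (μ {x} - s) • Measure.dirac x +
        ENNReal.ofReal s • Measure.dirac c) := by
  -- Once the atom at `x` is split off, the bound is the triangle inequality. It may be strict,
  -- since the mass arriving at `c` can cancel against `μ`.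
  have h : (μ + (s • VectorMeasure.dirac c 1 - s • VectorMeasure.dirac x 1) : SignedMeasure ℝ) =
      μ.restrict {x}ᶜ + (VectorMeasure.dirac x (μ {x} - s) + VectorMeasure.dirac c s) := by
    ext E hE
    have hE' : μ E = μ (E ∩ {x}ᶜ) + VectorMeasure.dirac x (μ {x}) E := by
      by_cases hx : x ∈ E
      · rw [VectorMeasure.dirac_apply_of_mem hE hx, ← VectorMeasure.of_union
          (disjoint_compl_left.mono_left inter_subset_right)
          (hE.inter (measurableSet_singleton x).compl) (measurableSet_singleton x)]
        congr 1
        ext t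
        by_cases ht : t = x <;> simp [ht, hx]
      · rw [VectorMeasure.dirac_apply_of_notMem hx, add_zero, inter_eq_self_of_subset_left]
        simpa using hx
    simp only [add_apply, sub_apply, smul_apply,
      VectorMeasure.restrict_apply _ (measurableSet_singleton x).compl hE]
    rw [hE']
    by_cases hx : x ∈ E <;> by_cases hc : c ∈ E <;> simp [hx, hc, hE]
    ring
  rw [h]
  grw [VectorMeasure.variation_add_le, VectorMeasure.variation_add_le]
  refine add_le_add ?_ (add_le_add ?_ ?_)
  · exact (VectorMeasure.variation_restrict (measurableSet_singleton x).compl).le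
  · rw [VectorMeasure.variation_dirac, Real.enorm_of_nonneg (sub_nonneg.2 hsx)]
  · rw [VectorMeasure.variation_dirac, Real.enorm_of_nonneg hs]

lemma setIntegral_Ioo_smul_dirac (hc : c ∈ Ioo a b) (hs : 0 ≤ s) :
    ∫ t in Ioo a b, α t ∂(ENNReal.ofReal s • Measure.dirac c) = s * α c := by
  classical
  rw [Measure.restrict_smul, integral_smul_measure, setIntegral_dirac, if_pos hc, ENNReal.toReal_ofReal hs, smul_eq_mul]

lemma setIntegral_variation_add_move_atom_le (hα : ContinuousOn α (Icc a b))
    (hα_nonneg : ∀ t ∈ Icc a b, 0 ≤ α t) (hx : x ∈ Ioo a b) (hc : c ∈ Ioo a b) (hs : 0 ≤ s)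
    (hsx : s ≤ μ {x}) :
    ∫ t in Ioo a b, α t ∂(μ + (s • VectorMeasure.dirac c 1 - s • VectorMeasure.dirac x 1) :
      SignedMeasure ℝ).variation ≤ (∫ t in Ioo a b, α t ∂μ.variation) + s * (α c - α x) := by
  have hint : ∀ m : Measure ℝ, IsFiniteMeasure m → IntegrableOn α (Ioo a b) m := fun m _ ↦
    (hα.integrableOn_compact isCompact_Icc).mono_set Ioo_subset_Icc_self
  have hfin : ∀ (r y : ℝ), IsFiniteMeasure (ENNReal.ofReal r • Measure.dirac y) := fun r y ↦
    Measure.smul_finite _ ENNReal.ofReal_ne_top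
  -- The atom is nonnegative, so `μ.variation` has mass exactly `μ {x}` at `x`.
  have h1 : ∫ t in Ioo a b, α t ∂μ.variation =
      (∫ t in Ioo a b, α t ∂μ.variation.restrict {x}ᶜ) + μ {x} * α x := by
    have hdecomp : μ.variation = μ.variation.restrict {x}ᶜ +
        ENNReal.ofReal (μ {x}) • Measure.dirac x := by
      conv_lhs => rw [← Measure.restrict_add_restrict_compl (μ := μ.variation)
        (measurableSet_singleton x), Measure.restrict_singleton,
        SignedMeasure.variation_singleton, Real.enorm_of_nonneg (hs.trans hsx), add_comm]
    conv_lhs => rw [hdecomp]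
    rw [Measure.restrict_add, integral_add_measure (hint _ inferInstance) (hint _ (hfin _ _)),
      setIntegral_Ioo_smul_dirac hx (hs.trans hsx)]
  have hf1 := hfin (μ {x} - s) x
  have hf2 := hfin s c
  have h2 : ∫ t in Ioo a b, α t ∂(μ.variation.restrict {x}ᶜ +
      (ENNReal.ofReal (μ {x} - s) • Measure.dirac x + ENNReal.ofReal s • Measure.dirac c)) =
      (∫ t in Ioo a b, α t ∂μ.variation.restrict {x}ᶜ) + ((μ {x} - s) * α x + s * α c) := by
    rw [Measure.restrict_add, integral_add_measure (hint _ inferInstance) (hint _ inferInstance),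
      Measure.restrict_add, integral_add_measure (hint _ inferInstance) (hint _ inferInstance),
      setIntegral_Ioo_smul_dirac hx (sub_nonneg.2 hsx), setIntegral_Ioo_smul_dirac hc hs]
  have h3 := integral_mono_measure (f := α)
    (Measure.restrict_mono subset_rfl (SignedMeasure.variation_add_move_atom_le hs hsx c))
    (ae_restrict_of_forall_mem measurableSet_Ioo fun t ht ↦ hα_nonneg t (Ioo_subset_Icc_self ht))
    (hint _ inferInstance)
  rw [h2] at h3
  rw [h1]
  linarith

/-! ### First-order optimality and comparison of jumps. -/

/-- At a positive jump of a minimiser, comparing with the functions obtained by moving the jump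
from `x` to `c` yields the first-order optimality condition. -/
lemma IsWeightedTVSolution.integral_sub_le {Df Du : SignedMeasure ℝ} (hf : HasBVDeriv a b f Df)
    (hα : ContinuousOn α (Icc a b)) (hα_nonneg : ∀ t ∈ Icc a b, 0 ≤ α t)
    (hu : IsWeightedTVSolution a b α f u Du) (hx : x ∈ Ioo a b) (hc : c ∈ Ioo a b)
    (hpos : 0 < Du {x}) : ∫ t in c..x, (f t - u t) ≤ α c - α x := by
  have hg := hf.sub hu.hasBVDeriv
  set g := fun t ↦ f t - u t with hg_def
  -- Up to sign, the indicator of the interval between `c` and `x`; both orders of `c` and `x` are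
  -- covered.
  set q : ℝ → ℝ := fun t ↦ (Ioi c).indicator (fun _ ↦ 1) t - (Ioi x).indicator (fun _ ↦ 1) t
    with hq_def
  have hq_meas : Measurable q :=
    (measurable_const.indicator measurableSet_Ioi).sub
      (measurable_const.indicator measurableSet_Ioi)
  have hq_le : ∀ t, ‖q t‖ ≤ 1 := fun t ↦ by
    simp only [hq_def, indicator]
    split_ifs <;> simp
  -- Without square integrability the fidelity integral would take the default value `0` and could
  -- not be expanded.
  obtain ⟨C, hC⟩ := hg.exists_ae_abs_le
  have hgg : IntegrableOn (fun t ↦ g t * g t) (Ioo a b) :=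
    Integrable.mul_bdd (c := C) hg.integrableOn hg.integrableOn.aestronglyMeasurable hC
  have hg2 : IntegrableOn (fun t ↦ (f t - u t) ^ 2) (Ioo a b) := by
    simp only [sq]; exact hgg
  have hgq : IntegrableOn (fun t ↦ g t * q t) (Ioo a b) :=
    Integrable.mul_bdd (c := 1) hg.integrableOn hq_meas.aestronglyMeasurable (.of_forall hq_le)
  have hqq : IntegrableOn (fun t ↦ q t * q t) (Ioo a b) := by
    have hq : IntegrableOn q (Ioo a b) :=
      Integrable.of_bound hq_meas.aestronglyMeasurable 1 (.of_forall hq_le)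
    exact Integrable.mul_bdd (c := 1) hq hq_meas.aestronglyMeasurable (.of_forall hq_le)
  have hI : ∫ t in Ioo a b, g t * q t = ∫ t in c..x, g t :=
    setIntegral_Ioo_mul_indicator_Ioi_sub hg.integrableOn hc hx
  set Q := ∫ t in Ioo a b, q t * q t
  -- Minimality, with the square expanded, divided by `s`.
  have key : ∀ s, 0 < s → s ≤ Du {x} → ∫ t in c..x, g t ≤ α c - α x + s * (Q / 2) := by
    intro s hs hsx
    have hw := hu.hasBVDeriv.add (((hasBVDeriv_indicator_Ioi hc).const_mul s).sub
      ((hasBVDeriv_indicator_Ioi hx).const_mul s))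
    have hmin := hu.minimal _ _ hw
    simp only [weightedTVEnergy, SignedMeasure.totalVariation_eq_variation] at hmin
    have hTV := setIntegral_variation_add_move_atom_le (μ := Du) hα hα_nonneg hx hc hs.le hsx
    have hL2 : ∫ t in Ioo a b, (f t - (u t + (s * (Ioi c).indicator (fun _ ↦ 1) t -
        s * (Ioi x).indicator (fun _ ↦ 1) t))) ^ 2 =
        (∫ t in Ioo a b, (f t - u t) ^ 2) - 2 * s * (∫ t in c..x, g t) + s ^ 2 * Q := by
      rw [← hI, ← integral_const_mul, ← integral_const_mul, ← integral_sub, ← integral_add]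
      · congr 1
        ext t
        simp only [hg_def, hq_def]
        ring
      · exact hg2.sub (hgq.const_mul _)
      · exact hqq.const_mul _
      · exact hg2
      · exact hgq.const_mul _
    rw [hL2] at hmin
    have : 0 ≤ s * (α c - α x + s * (Q / 2) - ∫ t in c..x, g t) := by nlinarith
    have := nonneg_of_mul_nonneg_right this hs
    linarith
  have hlim : Tendsto (fun s ↦ α c - α x + s * (Q / 2)) (𝓝[>] 0) (𝓝 (α c - α x)) := by
    have : Continuous fun s ↦ α c - α x + s * (Q / 2) := by fun_prop
    simpa using (this.tendsto 0).mono_left (nhdsWithin_le_nhds (s := Ioi 0))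
  refine ge_of_tendsto hlim ?_
  filter_upwards [Ioo_mem_nhdsGT hpos] with s hs using key s hs.1 hs.2.le

/-- A positive jump of the minimiser is at most the jump of the datum. -/
lemma IsWeightedTVSolution.jump_le_of_pos {α' : ℝ → ℝ} {Df Du Dα' : SignedMeasure ℝ}
    (hf : HasBVDeriv a b f Df) (hα : ContinuousOn α (Icc a b))
    (hα_nonneg : ∀ t ∈ Icc a b, 0 ≤ α t) (hα_deriv : HasWeakDeriv a b α α')
    (hα'_BV : HasBVDeriv a b α' Dα') (hu : IsWeightedTVSolution a b α f u Du)
    (hx : x ∈ Ioo a b) (hDα' : Dα' {x} = 0) (hpos : 0 < Du {x}) : Du {x} ≤ Df {x} := by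
  have hg := (hf.sub hu.hasBVDeriv).tendsto_means_sub hx
  have hα' := hα'_BV.tendsto_means_sub hx
  -- For each `ε` the inequality is the sum of the optimality conditions at `c = x - ε` and `c = x +
  -- ε`, divided by `ε`.
  have hle : -(Df - Du) {x} ≤ -(-Dα' {x}) := by
    refine le_of_tendsto_of_tendsto hg hα'.neg ?_
    filter_upwards [Ioo_mem_nhdsGT (sub_pos.2 hx.1), Ioo_mem_nhdsGT (sub_pos.2 hx.2)] with ε h1 h2
    have hl : x - ε ∈ Ioo a b := ⟨by linarith [h1.2], by linarith [h1.1, hx.2]⟩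
    have hr : x + ε ∈ Ioo a b := ⟨by linarith [h1.1, hx.1], by linarith [h2.2]⟩
    have k1 := hu.integral_sub_le hf hα hα_nonneg hx hl hpos
    have k2 := hu.integral_sub_le hf hα hα_nonneg hx hr hpos
    have hc := hα.mono Ioo_subset_Icc_self
    have k3 := hα_deriv.sub_eq_integral hc hl hx
    have k4 := hα_deriv.sub_eq_integral hc hx hr
    rw [intervalIntegral.integral_symm] at k2
    rw [← mul_neg]
    refine mul_le_mul_of_nonneg_left ?_ (inv_pos.2 h1.1).le
    linarith
  rw [hDα', sub_apply] at hle
  linarith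

end Optimality

theorem proposition3p9 (a b : ℝ) (f u α α' : ℝ → ℝ) (Df Du Dα' : SignedMeasure ℝ)
    (hf : HasBVDeriv a b f Df)
    (hα_cont : ContinuousOn α (Icc a b))
    (hα_pos : ∀ t ∈ Icc a b, 0 < α t)
    (hα_deriv : HasWeakDeriv a b α α')
    (hα'_BV : HasBVDeriv a b α' Dα')
    (hu : IsWeightedTVSolution a b α f u Du)
    (x : ℝ) (hx : x ∈ Ioo a b) (hDα' : Dα'.totalVariation {x} = 0) :
    Du.totalVariation {x} ≤ Df.totalVariation {x} ∧
      (0 < Du {x} → 0 < Df {x}) ∧ (Du {x} < 0 → Df {x} < 0) := by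
  have hα_nonneg : ∀ t ∈ Icc a b, 0 ≤ α t := fun t ht ↦ (hα_pos t ht).le
  have hjump := SignedMeasure.null_of_totalVariation_zero Dα' hDα'
  have hp : 0 < Du {x} → Du {x} ≤ Df {x} :=
    hu.jump_le_of_pos hf hα_cont hα_nonneg hα_deriv hα'_BV hx hjump
  have hn : Du {x} < 0 → Df {x} ≤ Du {x} := by
    intro h
    -- The weight `α` is unaffected by the sign change, so the same `hjump` serves.
    have := hu.neg.jump_le_of_pos hf.neg hα_cont hα_nonneg hα_deriv hα'_BV hx hjump (by simpa)
    simpa using this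
  refine ⟨?_, fun h ↦ h.trans_le (hp h), fun h ↦ (hn h).trans_lt h⟩
  rw [SignedMeasure.totalVariation_eq_variation, SignedMeasure.totalVariation_eq_variation,
    SignedMeasure.variation_singleton, SignedMeasure.variation_singleton, enorm_le_iff_norm_le,
    Real.norm_eq_abs, Real.norm_eq_abs]
  rcases lt_trichotomy (Du {x}) 0 with h | h | h
  · rw [abs_of_neg h, abs_of_neg ((hn h).trans_lt h)]
    linarith [hn h]
  · simp [h]
  · rw [abs_of_pos h, abs_of_pos (h.trans_le (hp h))]
    exact hp h
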